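/- For $n\ge 0$ let $\mathcal W_n^+$ be the set of all nearest-neighbour (not necessarily self-avoiding) paths $\eta=[\eta_0,\dots,\eta_n]$ of $n$ steps in $\mathbb Z^2$ with $\eta_0=(0,0)$ that stay in the upper half-plane $\{(x,y)\in\mathbb Z^2: y\ge 0\}$. Let $h(\eta)$ be the maximal second coordinate of the vertices $\eta_0,\dots,\eta_n$, and for a function $Y$ on paths put $$\langle Y\rangle_n^{+,\mathrm{simp}} = 4^{-n}\sum_{\eta\in\mathcal W_n^+} Y(\eta).$$ Then for every real $u>0$, as $n\to\infty$, $$\langle e^{-u h}\rangle_n^{+,\mathrm{simp}} \sim A_u\, n^{-1/6}\exp\{-\lambda_u n^{1/3}\},$$ where $$A_u = 2^{8/3}\,3^{-1/2}\,\pi^{1/6}\,u^{-1/3}\,e^u(e^u-1),\qquad \lambda_u = 2^{-4/3}\cdot 3\cdot \pi^{2/3}\,u^{2/3},$$ and $a_n\sim b_n$ means $a_n/b_n\to 1$. -/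

import Mathlib

open scoped Asymptotics

/-- The set of nearest-neighbour (not necessarily self-avoiding) lattice paths
`η = [η 0, …, η n]` of `n` steps in `ℤ × ℤ`, started at the origin and staying in the upper
half-plane `{(x, y) : 0 ≤ y}`. -/
def halfPlanePaths (n : ℕ) : Set (Fin (n + 1) → ℤ × ℤ) :=
  {η | η 0 = (0, 0) ∧
    (∀ i : Fin n,
      |(η i.succ).1 - (η i.castSucc).1| + |(η i.succ).2 - (η i.castSucc).2| = 1) ∧
    ∀ j : Fin (n + 1), 0 ≤ (η j).2}

theorem halfPlanePaths_finite (n : ℕ) : (halfPlanePaths n).Finite := by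
  apply Set.Finite.subset (Set.Finite.pi' (fun j : Fin (n + 1) =>
    (Set.finite_Icc (-(j : ℤ)) (j : ℤ)).prod (Set.finite_Icc (-(j : ℤ)) (j : ℤ))))
  rintro η ⟨h0, hs, -⟩ j
  induction j using Fin.induction with
  | zero => simp [h0]
  | succ i ih =>
    have h := hs i
    simp only [Set.mem_prod, Set.mem_Icc, Fin.val_castSucc, Fin.val_succ] at ih ⊢
    push_cast
    have h1 := abs_nonneg ((η i.succ).1 - (η i.castSucc).1)
    have h2 := abs_nonneg ((η i.succ).2 - (η i.castSucc).2)
    have h3 := abs_le.1 (show |(η i.succ).1 - (η i.castSucc).1| ≤ 1 by omega)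
    have h4 := abs_le.1 (show |(η i.succ).2 - (η i.castSucc).2| ≤ 1 by omega)
    omega

/-- The maximal height (second coordinate) `h(η) = max {y(η j) : j = 0, …, n}` of a path. -/
def maxHeight {n : ℕ} (η : Fin (n + 1) → ℤ × ℤ) : ℤ :=
  Finset.univ.sup' Finset.univ_nonempty (fun j => (η j).2)

/-- `⟨Y⟩ = 4⁻ⁿ ∑ Y(η)`, the sum being over all `n`-step nearest-neighbour paths from the origin
that stay in the upper half-plane: the (unnormalised) expectation of `Y` for simple random walk
restricted to the half-plane. -/
noncomputable def halfPlaneExpectation (n : ℕ) (Y : (Fin (n + 1) → ℤ × ℤ) → ℝ) : ℝ :=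
  ((4 : ℝ) ^ n)⁻¹ * ∑ η ∈ (halfPlanePaths_finite n).toFinset, Y η

/-- The amplitude `A_u`. -/
noncomputable def amplitudeConst (u : ℝ) : ℝ :=
  (2 : ℝ) ^ (8 / 3 : ℝ) * (3 : ℝ) ^ (-(1 / 2) : ℝ) * Real.pi ^ (1 / 6 : ℝ) * u ^ (-(1 / 3) : ℝ) *
    (Real.exp u * (Real.exp u - 1))

/-- The rate `λ_u`. -/
noncomputable def rateConst (u : ℝ) : ℝ :=
  (2 : ℝ) ^ (-(4 / 3) : ℝ) * 3 * Real.pi ^ (2 / 3 : ℝ) * u ^ (2 / 3 : ℝ)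

/-! Summing a geometric tail gives e^{-uh} = (1 - e^{-u}) Σ_{H ≥ h} e^{-uH}, so the expectation is a
weighted sum over H of the probabilities of staying in a strip 0 ≤ y ≤ H
(`hasSum_halfPlaneExpectation`). With N = H + 2, diagonalising the walk killed at -1 and H + 1 gives
these exactly, as (2/N) Σ_m cos(θ_m/2)^{2n+2} with θ_m = (2m+1)π/N (`card_stripPaths`).

The two extremal modes together give (4/N) cos(π/(2N))^{2n+2}, which is close to (4/N)
exp(-nπ²/(4N²)). The exponent uN + nπ²/(4N²) is least at N = a with a³ = nπ²/(2u), where it equals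
3ua/2. Its fluctuations are Gaussian on the scale √a, so Laplace's method yields the leading
constant (`tendsto_sqrt_mul_tsum_saddlePhase`, `tendsto_leadingTerm`). The other modes have at least
9π² in place of π², which makes them exponentially smaller in a (`errorTerm_le`). -/

/-! ### Paths in a strip and the transfer operator -/

/-- The four unit steps of the square lattice. -/
def latticeSteps : Finset (ℤ × ℤ) := {(1, 0), (-1, 0), (0, 1), (0, -1)}

theorem mem_latticeSteps (d : ℤ × ℤ) : d ∈ latticeSteps ↔ |d.1| + |d.2| = 1 := by
  obtain ⟨x, y⟩ := d
  simp only [latticeSteps, Finset.mem_insert, Finset.mem_singleton, Prod.mk.injEq]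
  constructor
  · rintro (⟨rfl, rfl⟩ | ⟨rfl, rfl⟩ | ⟨rfl, rfl⟩ | ⟨rfl, rfl⟩) <;> simp
  · intro h
    rcases abs_cases x with hx | hx <;> rcases abs_cases y with hy | hy <;> omega

/-- The half-plane paths of height at most `H`. -/
noncomputable def stripPaths (n : ℕ) (H : ℤ) : Finset (Fin (n + 1) → ℤ × ℤ) :=
  (halfPlanePaths_finite n).toFinset.filter fun η => maxHeight η ≤ H

theorem mem_stripPaths {n : ℕ} {H : ℤ} {η : Fin (n + 1) → ℤ × ℤ} :
    η ∈ stripPaths n H ↔ η 0 = (0, 0) ∧ (∀ i : Fin n, η i.succ - η i.castSucc ∈ latticeSteps) ∧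
      ∀ j, 0 ≤ (η j).2 ∧ (η j).2 ≤ H := by
  simp only [stripPaths, Finset.mem_filter, Set.Finite.mem_toFinset, halfPlanePaths,
    Set.mem_ofPred_eq, maxHeight, Finset.sup'_le_iff, Finset.mem_univ, true_implies,
    mem_latticeSteps, Prod.fst_sub, Prod.snd_sub, forall_and, and_assoc]

theorem sum_stripPaths_succ (n : ℕ) (H : ℤ) (f : (Fin (n + 2) → ℤ × ℤ) → ℝ) :
    ∑ η ∈ stripPaths (n + 1) H, f η =
      ∑ η ∈ stripPaths n H, ∑ d ∈ latticeSteps,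
        if 0 ≤ (η (Fin.last n)).2 + d.2 ∧ (η (Fin.last n)).2 + d.2 ≤ H then
          f (Fin.snoc η (η (Fin.last n) + d) : Fin (n + 2) → ℤ × ℤ) else 0 := by
  rw [← Finset.sum_product', ← Finset.sum_filter]
  refine Finset.sum_bij'
    (fun η _ => ((Fin.init η : Fin (n + 1) → ℤ × ℤ),
      η (Fin.last (n + 1)) - η (Fin.last n).castSucc))
    (fun p _ => (Fin.snoc p.1 (p.1 (Fin.last n) + p.2) : Fin (n + 2) → ℤ × ℤ)) ?_ ?_ ?_ ?_ ?_
  · intro η hη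
    rw [mem_stripPaths] at hη
    obtain ⟨h0, hs, hb⟩ := hη
    simp only [Finset.mem_filter, Finset.mem_product, mem_stripPaths, Fin.init]
    refine ⟨⟨⟨h0, fun i => hs i.castSucc, fun j => hb _⟩, hs (Fin.last n)⟩, ?_⟩
    simpa using hb (Fin.last (n + 1))
  · rintro ⟨η, d⟩ hp
    simp only [Finset.mem_filter, Finset.mem_product, mem_stripPaths] at hp
    obtain ⟨⟨⟨h0, hs, hb⟩, hd⟩, hH⟩ := hp
    rw [mem_stripPaths]
    refine ⟨?_, ?_, ?_⟩
    · have : (0 : Fin (n + 2)) = (0 : Fin (n + 1)).castSucc := rfl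
      rw [this, Fin.snoc_castSucc]; exact h0
    · intro i
      induction i using Fin.lastCases with
      | last => rw [Fin.succ_last, Fin.snoc_last, Fin.snoc_castSucc]; simpa using hd
      | cast i => rw [Fin.succ_castSucc, Fin.snoc_castSucc, Fin.snoc_castSucc]; exact hs i
    · intro j
      induction j using Fin.lastCases with
      | last => rw [Fin.snoc_last]; exact hH
      | cast i => rw [Fin.snoc_castSucc]; exact hb i
  · intro η _
    simp only [Fin.init, add_sub_cancel]
    exact Fin.snoc_init_self η
  · rintro ⟨η, d⟩ _
    simp [Fin.init_snoc]
  · intro η _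
    congr 1
    simp only [Fin.init, add_sub_cancel]
    exact (Fin.snoc_init_self η).symm

/-- Induction on the last step: the two horizontal steps contribute 2g(y), the vertical ones g(y ±
1). The zeros of g just outside the strip absorb the constraint on the new vertex. -/
theorem sum_stripPaths_eigenfunction (n : ℕ) {H : ℤ} (hH : 0 ≤ H) (g : ℤ → ℝ) (μ : ℝ)
    (hl : g (-1) = 0) (hr : g (H + 1) = 0)
    (hg : ∀ y, g (y + 1) + g (y - 1) + 2 * g y = μ * g y) :
    ∑ η ∈ stripPaths n H, g (η (Fin.last n)).2 = μ ^ n * g 0 := by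
  induction n with
  | zero =>
    have : stripPaths 0 H = {fun _ => (0, 0)} := by
      ext η
      rw [mem_stripPaths, Finset.mem_singleton]
      constructor
      · rintro ⟨h, -⟩
        funext j
        rw [show j = 0 from Fin.ext (by omega), h]
      · rintro rfl
        simp [hH]
    simp [this]
  | succ n ih =>
    rw [sum_stripPaths_succ, pow_succ, mul_right_comm, ← ih, Finset.sum_mul]
    refine Finset.sum_congr rfl fun η hη => ?_
    have hb := (mem_stripPaths.1 hη).2.2 (Fin.last n)
    set y := (η (Fin.last n)).2
    have key : ∀ z, -1 ≤ z → z ≤ H + 1 → (if 0 ≤ z ∧ z ≤ H then g z else 0) = g z := by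
      intro z h1 h2
      split_ifs with h
      · rfl
      · obtain rfl | rfl : z = -1 ∨ z = H + 1 := by omega
        · exact hl.symm
        · exact hr.symm
    have h0 := key y (by omega) (by omega)
    have h1 := key (y + 1) (by omega) (by omega)
    have h2 := key (y - 1) (by omega) (by omega)
    simp only [Fin.snoc_last, Prod.snd_add]
    rw [latticeSteps, Finset.sum_insert (by decide), Finset.sum_insert (by decide),
      Finset.sum_insert (by decide), Finset.sum_singleton]
    simp only [add_zero, ← sub_eq_add_neg]
    rw [h0, h1, h2]
    linarith [hg y]

/-! ### Dirichlet modes and the exact strip count -/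

/-- The odd multiples of `π / N`. -/
noncomputable def oddAngle (N m : ℕ) : ℝ := (2 * m + 1) * Real.pi / N

theorem sum_cos_oddAngle {N j : ℕ} (hj : 0 < j) (hjN : j < N) :
    ∑ m ∈ Finset.range N, Real.cos (j * oddAngle N m) = 0 := by
  have hN : (N : ℝ) ≠ 0 := by exact_mod_cast (hj.trans hjN).ne'
  have hs : Real.sin (j * Real.pi / N) ≠ 0 := by
    apply ne_of_gt
    apply Real.sin_pos_of_pos_of_lt_pi
    · have : (0 : ℝ) < j := by exact_mod_cast hj
      positivity
    · rw [div_lt_iff₀ (by positivity), mul_comm]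
      have : (j : ℝ) < N := by exact_mod_cast hjN
      gcongr
  -- Multiplication by 2 sin(jπ/N), half the angular increment, makes the sum telescope.
  have key : ∀ K : ℕ, 2 * Real.sin (j * Real.pi / N) *
      ∑ m ∈ Finset.range K, Real.cos (j * oddAngle N m) = Real.sin (2 * K * (j * Real.pi / N)) := by
    intro K
    induction K with
    | zero => simp
    | succ K ih =>
      rw [Finset.sum_range_succ, mul_add, ih]
      have h1 : 2 * ((K + 1 : ℕ) : ℝ) * (j * Real.pi / N) =
        j * oddAngle N K + j * Real.pi / N := by
        simp only [oddAngle]; push_cast; field_simp; ring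
      have h2 : 2 * (K : ℝ) * (j * Real.pi / N) =
        j * oddAngle N K - j * Real.pi / N := by
        simp only [oddAngle]; field_simp; ring
      rw [h1, h2, Real.sin_add, Real.sin_sub]
      ring
  have h := key N
  have h2 : 2 * (N : ℝ) * (j * Real.pi / N) = j * (2 * Real.pi) := by field_simp
  rw [h2, show (j : ℝ) * (2 * Real.pi) = ((2 * j : ℕ) : ℝ) * Real.pi by push_cast; ring,
    Real.sin_nat_mul_pi] at h
  simpa [hs] using h

theorem sin_half_oddAngle_pos {N m : ℕ} (hm : m < N) : 0 < Real.sin (oddAngle N m / 2) := by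
  have hN : (0 : ℝ) < N := by exact_mod_cast (Nat.zero_le m).trans_lt hm
  have hm' : (m : ℝ) + 1 ≤ N := by exact_mod_cast hm
  apply Real.sin_pos_of_pos_of_lt_pi
  · unfold oddAngle; positivity
  · rw [oddAngle, div_div, div_lt_iff₀ (by positivity), mul_comm]
    gcongr
    linarith

/-- This expands the constant function in the sine modes. Passing from j to j + 1 adds the sums of
cos(jθ) and cos((j+1)θ), which both vanish; for j = 1 the summand is 1 + cos θ. -/
theorem sum_cot_mul_sin_oddAngle {N j : ℕ} (hj : 0 < j) (hjN : j < N) :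
    ∑ m ∈ Finset.range N,
      Real.cos (oddAngle N m / 2) / Real.sin (oddAngle N m / 2) * Real.sin (j * oddAngle N m) =
      N := by
  induction j, hj using Nat.le_induction with
  | base =>
    rw [← add_zero (N : ℝ), ← sum_cos_oddAngle (N := N) (j := 1) one_pos hjN]
    have : (N : ℝ) = ∑ m ∈ Finset.range N, 1 := by simp
    conv_rhs => rw [this]
    rw [← Finset.sum_add_distrib]
    refine Finset.sum_congr rfl fun m hm => ?_
    have h := (sin_half_oddAngle_pos (Finset.mem_range.1 hm)).ne'
    have e : oddAngle N m = 2 * (oddAngle N m / 2) := by ring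
    simp only [Nat.succ_eq_add_one, zero_add, Nat.cast_one, one_mul]
    conv_lhs => rw [e]
    conv_rhs => rw [e]
    rw [mul_div_cancel_left₀ _ (two_ne_zero), Real.sin_two_mul, Real.cos_two_mul]
    field_simp
    ring
  | succ j hj ih =>
    rw [← ih (by omega)]
    rw [← sub_eq_zero, ← Finset.sum_sub_distrib]
    rw [← add_zero (0 : ℝ), ← sum_cos_oddAngle (N := N) (j := j) hj (by omega)]
    nth_rewrite 2 [sum_cos_oddAngle (N := N) (j := j) hj (by omega)]
    rw [← sum_cos_oddAngle (N := N) (j := j + 1) (by omega) hjN, ← Finset.sum_add_distrib]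
    refine Finset.sum_congr rfl fun m hm => ?_
    have h := (sin_half_oddAngle_pos (Finset.mem_range.1 hm)).ne'
    have e : ((j + 1 : ℕ) : ℝ) * oddAngle N m = j * oddAngle N m + 2 * (oddAngle N m / 2) := by
      push_cast; ring
    rw [e, Real.sin_add, Real.cos_add, Real.sin_two_mul, Real.cos_two_mul]
    have := Real.sin_sq_add_cos_sq (oddAngle N m / 2)
    generalize oddAngle N m / 2 = x at *
    generalize (j : ℝ) * oddAngle N m = y at *
    field_simp
    linear_combination (2 * Real.cos x * Real.sin y) * this

/-- Each path is counted through the mode expansion at j = y + 1, y being its final height. The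
eigenvalue is 4cos²(θ/2), and the initial value cot(θ/2) sin θ = 2cos²(θ/2) supplies the two extra
powers of the cosine. -/
theorem card_stripPaths (n H : ℕ) :
    (stripPaths n H).card / (4 : ℝ) ^ n =
      2 / (H + 2 : ℕ) * ∑ m ∈ Finset.range (H + 2), Real.cos (oddAngle (H + 2) m / 2) ^ (2 * n + 2) := by
  set N := H + 2 with hN
  have hN0 : (N : ℝ) ≠ 0 := by positivity
  have h1 : ∀ η ∈ stripPaths n H, (N : ℝ) = ∑ m ∈ Finset.range N,
      Real.cos (oddAngle N m / 2) / Real.sin (oddAngle N m / 2) *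
        Real.sin (((η (Fin.last n)).2 + 1 : ℝ) * oddAngle N m) := by
    intro η hη
    have hb := (mem_stripPaths.1 hη).2.2 (Fin.last n)
    obtain ⟨k, hk⟩ := Int.eq_ofNat_of_zero_le hb.1
    rw [hk] at hb ⊢
    rw [← sum_cot_mul_sin_oddAngle (N := N) (j := k + 1) (by omega) (by omega)]
    simp
  have h2 : (N : ℝ) * (stripPaths n H).card = ∑ η ∈ stripPaths n H, (N : ℝ) := by simp [mul_comm]
  have h3 : (N : ℝ) * (stripPaths n H).card = ∑ m ∈ Finset.range N,
      2 * 4 ^ n * Real.cos (oddAngle N m / 2) ^ (2 * n + 2) := by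
    rw [h2, Finset.sum_congr rfl h1, Finset.sum_comm]
    refine Finset.sum_congr rfl fun m hm => ?_
    have hs := (sin_half_oddAngle_pos (Finset.mem_range.1 hm)).ne'
    rw [← Finset.mul_sum, sum_stripPaths_eigenfunction n (H := H) (by omega)
      (fun y => Real.sin ((y + 1 : ℝ) * oddAngle N m)) (4 * Real.cos (oddAngle N m / 2) ^ 2)]
    · simp only [Int.cast_zero, zero_add, one_mul]
      have e : oddAngle N m = 2 * (oddAngle N m / 2) := by ring
      have e2 : Real.sin (oddAngle N m) =
          2 * Real.sin (oddAngle N m / 2) * Real.cos (oddAngle N m / 2) := by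
        conv_lhs => rw [e]
        rw [Real.sin_two_mul]
      rw [e2, mul_pow, ← pow_mul]
      field_simp
      ring
    · simp
    · have : (((H : ℤ) + 1 : ℤ) + 1 : ℝ) * oddAngle N m = ((2 * m + 1 : ℕ) : ℝ) * Real.pi := by
        have : (((H : ℤ) + 1 : ℤ) + 1 : ℝ) = N := by rw [hN]; push_cast; ring
        rw [this, oddAngle]
        push_cast
        field_simp
      rw [this, Real.sin_nat_mul_pi]
    · intro y
      have e1 : ((y + 1 : ℤ) + 1 : ℝ) * oddAngle N m =
        (y + 1 : ℝ) * oddAngle N m + 2 * (oddAngle N m / 2) := by push_cast; ring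
      have e2 : ((y - 1 : ℤ) + 1 : ℝ) * oddAngle N m =
        (y + 1 : ℝ) * oddAngle N m - 2 * (oddAngle N m / 2) := by push_cast; ring
      rw [e1, e2, Real.sin_add, Real.sin_sub, Real.cos_two_mul]
      ring
  rw [← Finset.mul_sum] at h3
  have h4 : (4 : ℝ) ^ n ≠ 0 := by positivity
  field_simp
  linear_combination h3

/-! ### From the maximal height to strip counts -/

theorem maxHeight_nonneg {n : ℕ} {η : Fin (n + 1) → ℤ × ℤ} (hη : η ∈ halfPlanePaths n) :
    0 ≤ maxHeight η :=
  (hη.2.2 0).trans (Finset.le_sup' (fun j => (η j).2) (Finset.mem_univ 0))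

theorem hasSum_exp_neg_mul_ite {u : ℝ} (hu : 0 < u) (h : ℕ) :
    HasSum (fun H : ℕ => (1 - Real.exp (-u)) * Real.exp (-u * H) * if h ≤ H then 1 else 0)
      (Real.exp (-u * h)) := by
  have hlt : Real.exp (-u) < 1 := by simpa using hu
  have h1 := ((hasSum_geometric_of_lt_one (Real.exp_pos (-u)).le hlt).mul_left
    ((1 - Real.exp (-u)) * Real.exp (-u * h)))
  have h2 : (1 - Real.exp (-u)) * Real.exp (-u * h) * (1 - Real.exp (-u))⁻¹ =
      Real.exp (-u * h) := by
    have : 1 - Real.exp (-u) ≠ 0 := by linarith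
    field_simp
  rw [h2] at h1
  have hinj : Function.Injective (fun k : ℕ => k + h) := add_left_injective h
  rw [← hinj.hasSum_iff]
  · refine h1.congr_fun ?_
    intro k
    simp only [Function.comp, le_add_iff_nonneg_left, zero_le, if_true, mul_one]
    rw [← Real.exp_nat_mul, mul_assoc, ← Real.exp_add]
    congr 2
    push_cast
    ring
  · intro H hH
    rw [if_neg, mul_zero]
    intro hle
    exact hH ⟨H - h, Nat.sub_add_cancel hle⟩

theorem hasSum_halfPlaneExpectation {u : ℝ} (hu : 0 < u) (n : ℕ) :
    HasSum (fun H : ℕ => (1 - Real.exp (-u)) * Real.exp (-u * H) *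
        ((stripPaths n H).card / (4 : ℝ) ^ n))
      (halfPlaneExpectation n fun η => Real.exp (-u * (maxHeight η : ℝ))) := by
  have h1 : HasSum (fun H : ℕ => ∑ η ∈ (halfPlanePaths_finite n).toFinset,
      ((1 - Real.exp (-u)) * Real.exp (-u * H) * if maxHeight η ≤ H then 1 else 0))
      (∑ η ∈ (halfPlanePaths_finite n).toFinset, Real.exp (-u * (maxHeight η : ℝ))) := by
    refine hasSum_sum fun η hη => ?_
    obtain ⟨k, hk⟩ := Int.eq_ofNat_of_zero_le
      (maxHeight_nonneg ((halfPlanePaths_finite n).mem_toFinset.1 hη))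
    simpa [hk] using hasSum_exp_neg_mul_ite hu k
  refine (h1.mul_left ((4 : ℝ) ^ n)⁻¹).congr_fun ?_
  intro H
  rw [← Finset.mul_sum, Finset.sum_boole, stripPaths]
  ring

/-! ### Laplace's method for the discrete sum -/

open Filter Topology MeasureTheory

/-- Writing the series as the integral of a step function makes dominated convergence available
after rescaling. -/
theorem hasSum_integral_comp_floor {g : ℤ → ℝ} (hg : Integrable fun x : ℝ => g ⌊x⌋) :
    HasSum g (∫ x : ℝ, g ⌊x⌋) := by
  refine hg.hasSum_intervalIntegral_comp_add_int.congr_fun fun n => ?_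
  rw [intervalIntegral.integral_of_le zero_le_one, integral_Ioc_eq_integral_Ioo,
    setIntegral_congr_fun (g := fun _ => g n) measurableSet_Ioo]
  · simp
  · intro x hx
    have : ⌊x⌋ = 0 := Int.floor_eq_zero_iff.2 ⟨hx.1.le, hx.2⟩
    simp [this]

theorem integrable_exp_neg_mul_abs {u : ℝ} (hu : 0 < u) :
    Integrable fun t : ℝ => Real.exp (-u * |t|) := by
  have h : IntegrableOn (fun t : ℝ => Real.exp (-u * |t|)) (Set.Ioi 0) := by
    refine (exp_neg_integrableOn_Ioi 0 hu).congr_fun (fun t ht => ?_) measurableSet_Ioi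
    simp only [abs_of_pos (show 0 < t from ht)]
  have h' : IntegrableOn (fun t : ℝ => Real.exp (-u * |t|)) (Set.Iio 0) := by
    have := h.comp_neg
    simpa using this
  rw [← integrableOn_univ, ← Set.Iic_union_Ioi (a := (0 : ℝ)), integrableOn_union]
  exact ⟨(integrableOn_Iic_iff_integrableOn_Iio (by simp)).2 h', h⟩

/-- With `s = k / a`, the quantity `a * (s + 1 / (2 * s ^ 2) - 3 / 2)`. -/
noncomputable def saddlePhase (a k : ℝ) : ℝ := (k - a) ^ 2 * (2 * k + a) / (2 * k ^ 2)

/-- The dominating function, uniform in a. With q = (a - k)/k, the phase is (k - a)²/k + aq²/2. The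
prefactor a/k = 1 + q ≤ e^q is absorbed by the second part; the first part is at least |t| - 2. -/
theorem saddlePhase_bound {a k t u : ℝ} (ha : 1 ≤ a) (hk : 0 < k) (hu : 0 < u)
    (hkt : |k - (a + √a * t)| ≤ 1) :
    a / k * Real.exp (-u * saddlePhase a k) ≤
      Real.exp (1 / (2 * u) + 2 * u) * Real.exp (-u * |t|) := by
  have ha0 : 0 < a := by linarith
  have hs : 1 ≤ √a := Real.one_le_sqrt.2 ha
  have hss : √a * √a = a := Real.mul_self_sqrt ha0.le
  set q := (a - k) / k with hq
  have e1 : a / k = q + 1 := by rw [hq]; field_simp; ring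
  have e2 : saddlePhase a k = (k - a) ^ 2 / k + a / 2 * q ^ 2 := by
    rw [saddlePhase, hq]; field_simp; ring
  have hq1 : q ≤ u * (a / 2 * q ^ 2) + 1 / (2 * u) := by
    have h1 : q ≤ u * (1 / 2 * q ^ 2) + 1 / (2 * u) := by
      rw [← sub_nonneg]
      have : u * (1 / 2 * q ^ 2) + 1 / (2 * u) - q = (u * q - 1) ^ 2 / (2 * u) := by
        field_simp; ring
      rw [this]; positivity
    have h2 : u * (1 / 2 * q ^ 2) ≤ u * (a / 2 * q ^ 2) := by gcongr
    linarith
  set τ := |k - a| / √a with hτ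
  have hτ0 : 0 ≤ τ := by positivity
  have hr : |k - a| = √a * τ := by rw [hτ]; field_simp
  have ht : |t| ≤ τ + 1 := by
    have h1 : √a * |t| ≤ √a * τ + 1 := by
      have h0 : √a * |t| = |√a * t| := by rw [abs_mul, abs_of_pos (show 0 < √a by linarith)]
      rw [← hr, h0]
      have := abs_sub_abs_le_abs_sub (√a * t) (k - a)
      rw [abs_sub_comm (√a * t), show k - a - √a * t = k - (a + √a * t) by ring] at this
      linarith
    by_contra! h
    nlinarith
  have hk2 : k ≤ a + √a * τ := by rw [← hr]; linarith [le_abs_self (k - a)]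
  have h3 : τ - 1 ≤ (k - a) ^ 2 / k := by
    rw [le_div_iff₀ hk, ← sq_abs, hr, mul_pow, sq √a, hss]
    rcases le_total τ 1 with h | h
    · have : (τ - 1) * k ≤ 0 := mul_nonpos_of_nonpos_of_nonneg (by linarith) hk.le
      nlinarith [mul_nonneg ha0.le (sq_nonneg τ)]
    · have hsa : √a ≤ a := by nlinarith
      have h5 : k ≤ a + a * τ := hk2.trans (by gcongr)
      have := mul_le_mul_of_nonneg_left h5 (show 0 ≤ τ - 1 by linarith)
      nlinarith
  calc a / k * Real.exp (-u * saddlePhase a k)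
      ≤ Real.exp q * Real.exp (-u * saddlePhase a k) := by
        rw [e1]; gcongr; exact Real.add_one_le_exp q
    _ ≤ _ := by
        rw [← Real.exp_add, ← Real.exp_add, Real.exp_le_exp, e2]
        have := mul_le_mul_of_nonneg_left (show |t| ≤ (k - a) ^ 2 / k + 2 by linarith) hu.le
        nlinarith

theorem tendsto_floor_saddle {a : ℕ → ℝ} (ha : Tendsto a atTop atTop) (t : ℝ) :
    Tendsto (fun n => ((⌊a n + √(a n) * t⌋ : ℝ) - a n) / √(a n)) atTop (𝓝 t) ∧
      Tendsto (fun n => (⌊a n + √(a n) * t⌋ : ℝ) / a n) atTop (𝓝 1) := by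
  have hs : Tendsto (fun n => √(a n)) atTop atTop := Real.tendsto_sqrt_atTop.comp ha
  have hi : Tendsto (fun n => (√(a n))⁻¹) atTop (𝓝 0) := hs.inv_tendsto_atTop
  have h1 : Tendsto (fun n => ((⌊a n + √(a n) * t⌋ : ℝ) - a n) / √(a n)) atTop (𝓝 t) := by
    rw [tendsto_iff_norm_sub_tendsto_zero]
    refine squeeze_zero' (Eventually.of_forall fun n => norm_nonneg _) ?_ hi
    filter_upwards [hs.eventually_gt_atTop 0] with n hn
    have : ((⌊a n + √(a n) * t⌋ : ℝ) - a n) / √(a n) - t =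
        (⌊a n + √(a n) * t⌋ - (a n + √(a n) * t)) * (√(a n))⁻¹ := by field_simp; ring
    rw [this, norm_mul, norm_inv, Real.norm_of_nonneg hn.le]
    refine mul_le_of_le_one_left (by positivity) ?_
    rw [Real.norm_eq_abs, abs_le]
    constructor
    · linarith [Int.lt_floor_add_one (a n + √(a n) * t)]
    · linarith [Int.floor_le (a n + √(a n) * t)]
  refine ⟨h1, ?_⟩
  have h2 := (h1.mul hi).const_add 1
  simp only [mul_zero, add_zero] at h2
  refine h2.congr' ?_
  filter_upwards [hs.eventually_gt_atTop 0, ha.eventually_gt_atTop 0] with n hn hn'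
  have := Real.mul_self_sqrt hn'.le
  rw [← div_eq_mul_inv, div_div, this]
  field_simp
  ring

/-- Laplace's method for a sum with saddle point `a n` and phase `saddlePhase`. -/
theorem tendsto_sqrt_mul_tsum_saddlePhase {u : ℝ} (hu : 0 < u) {a : ℕ → ℝ}
    (ha : Tendsto a atTop atTop) {w : ℕ → ℤ → ℝ} (hw0 : ∀ n k, 0 ≤ w n k)
    (hw1 : ∀ n k, w n k ≤ 1) (hwn : ∀ n k, k ≤ 0 → w n k = 0)
    (hw : ∀ k : ℕ → ℤ, Tendsto (fun n => (k n : ℝ) / a n) atTop (𝓝 1) →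
      Tendsto (fun n => w n (k n)) atTop (𝓝 1)) :
    Tendsto (fun n => √(a n) * ∑' k : ℤ, w n k * (k : ℝ)⁻¹ *
      Real.exp (-u * saddlePhase (a n) k)) atTop (𝓝 √(2 * Real.pi / (3 * u))) := by
  set G : ℕ → ℤ → ℝ := fun n k => w n k * (a n / k * Real.exp (-u * saddlePhase (a n) k)) with hG
  set F : ℕ → ℝ → ℝ := fun n t => G n ⌊a n + √(a n) * t⌋ with hF
  set C := Real.exp (1 / (2 * u) + 2 * u)
  have hmeas : ∀ n, Measurable (F n) := fun n =>
    (Measurable.of_discrete (f := G n)).comp (Int.measurable_floor.comp (by fun_prop))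
  have hbound : ∀ᶠ n in atTop, ∀ t, ‖F n t‖ ≤ C * Real.exp (-u * |t|) := by
    filter_upwards [ha.eventually_ge_atTop 1] with n hn t
    simp only [hF, hG]
    set k := ⌊a n + √(a n) * t⌋
    rcases le_or_gt k 0 with hk | hk
    · rw [hwn n k hk]; simp; positivity
    · have hk' : (0 : ℝ) < k := by exact_mod_cast hk
      have hb := saddlePhase_bound (t := t) hn hk' hu (by
        rw [abs_le]
        constructor
        · linarith [Int.lt_floor_add_one (a n + √(a n) * t)]
        · linarith [Int.floor_le (a n + √(a n) * t)])
      have hp : 0 ≤ a n / k * Real.exp (-u * saddlePhase (a n) k) := by positivity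
      rw [Real.norm_of_nonneg (mul_nonneg (hw0 _ _) hp)]
      exact (mul_le_of_le_one_left hp (hw1 n k)).trans hb
  have hint : Integrable fun t : ℝ => C * Real.exp (-u * |t|) :=
    (integrable_exp_neg_mul_abs hu).const_mul C
  have hlim : ∀ t, Tendsto (fun n => F n t) atTop (𝓝 (Real.exp (-(3 * u / 2) * t ^ 2))) := by
    intro t
    obtain ⟨h1, h2⟩ := tendsto_floor_saddle ha t
    have h3 := hw _ h2
    have h4 : Tendsto (fun n => a n / (⌊a n + √(a n) * t⌋ : ℝ)) atTop (𝓝 1) := by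
      simpa using h2.inv₀ one_ne_zero
    -- With s = k/a, the phase is ((k - a)²/a)(2s + 1)/(2s²), and s tends to 1.
    have h5 : Tendsto (fun n => saddlePhase (a n) ⌊a n + √(a n) * t⌋) atTop
        (𝓝 (t ^ 2 * ((2 * 1 + 1) / (2 * 1 ^ 2)))) := by
      refine ((h1.pow 2).mul (((h2.const_mul 2).add_const 1).div
        ((h2.pow 2).const_mul 2) (by norm_num))).congr' ?_
      filter_upwards [ha.eventually_gt_atTop 0] with n hn
      have := Real.sq_sqrt hn.le
      simp only [saddlePhase, Pi.div_apply]
      rw [div_pow, this]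
      field_simp
    have h6 := h3.mul (h4.mul ((Real.continuous_exp.tendsto _).comp (h5.const_mul (-u))))
    have e : Real.exp (-(3 * u / 2) * t ^ 2) =
        1 * (1 * Real.exp (-u * (t ^ 2 * ((2 * 1 + 1) / (2 * 1 ^ 2))))) := by
      rw [one_mul, one_mul]; congr 1; ring
    rw [e]
    exact h6
  have hmain := tendsto_integral_filter_of_dominated_convergence (μ := volume)
    (fun t => C * Real.exp (-u * |t|)) (Eventually.of_forall fun n => (hmeas n).aestronglyMeasurable)
    (hbound.mono fun n hn => Eventually.of_forall hn) hint (Eventually.of_forall hlim)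
  rw [integral_gaussian, show Real.pi / (3 * u / 2) = 2 * Real.pi / (3 * u) by field_simp] at hmain
  refine hmain.congr' ?_
  filter_upwards [hbound, ha.eventually_ge_atTop 1] with n hb hn
  have hs : 0 < √(a n) := Real.sqrt_pos.2 (by linarith)
  have hFi : Integrable (F n) := hint.mono' (hmeas n).aestronglyMeasurable (Eventually.of_forall hb)
  set f : ℝ → ℝ := fun x => G n ⌊x⌋
  have e : F n = fun t => (fun x => f (a n + x)) (√(a n) * t) := rfl
  have hfi : Integrable f := by
    rw [e, integrable_comp_mul_left_iff (fun x => f (a n + x)) hs.ne'] at hFi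
    simpa using hFi.comp_add_left (-(a n))
  have hsum := (hasSum_integral_comp_floor hfi).tsum_eq
  have e2 : ∫ t, F n t = (√(a n))⁻¹ * ∫ x, f x := by
    rw [e, Measure.integral_comp_mul_left (fun x => f (a n + x)), integral_add_left_eq_self,
      abs_of_pos (by positivity), smul_eq_mul]
  rw [e2, ← hsum, ← tsum_mul_left, ← tsum_mul_left]
  refine tsum_congr fun k => ?_
  simp only [hG]
  rw [← Real.mul_self_sqrt (show 0 ≤ a n by linarith)]
  field_simp
  rw [Real.sqrt_sq hs.le]

/-! ### Gaussian bounds for the cosine and the strip spectrum -/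

/-- The product cos x · exp(x²/2) decreases because x < tan x. -/
theorem cos_le_exp_neg_sq_div_two {x : ℝ} (h0 : 0 ≤ x) (h1 : x ≤ Real.pi / 2) :
    Real.cos x ≤ Real.exp (-(x ^ 2 / 2)) := by
  have hd : ∀ y : ℝ, HasDerivAt (fun x => Real.cos x * Real.exp (x ^ 2 / 2))
      ((-Real.sin y + y * Real.cos y) * Real.exp (y ^ 2 / 2)) y := by
    intro y
    have h := (Real.hasDerivAt_cos y).mul (((hasDerivAt_pow 2 y).div_const 2).exp)
    refine h.congr_deriv ?_
    push_cast
    ring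
  have hanti : AntitoneOn (fun x => Real.cos x * Real.exp (x ^ 2 / 2))
      (Set.Icc 0 (Real.pi / 2)) := by
    refine antitoneOn_of_deriv_nonpos (convex_Icc _ _)
      (fun y _ => (hd y).continuousAt.continuousWithinAt)
      (fun y _ => (hd y).differentiableAt.differentiableWithinAt) fun y hy => ?_
    rw [interior_Icc] at hy
    rw [(hd y).deriv]
    have hc : 0 < Real.cos y := Real.cos_pos_of_mem_Ioo ⟨by linarith [hy.1, hy.2], hy.2⟩
    have ht := Real.lt_tan hy.1 hy.2
    rw [Real.tan_eq_sin_div_cos, lt_div_iff₀ hc] at ht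
    exact mul_nonpos_of_nonpos_of_nonneg (by linarith) (Real.exp_pos _).le
  have h := hanti (Set.left_mem_Icc.2 (by positivity)) ⟨h0, h1⟩ h0
  simp only [Real.cos_zero, one_mul] at h
  rw [Real.exp_neg, ← one_div, le_div_iff₀ (Real.exp_pos _)]
  simpa using h

theorem abs_cos_le_exp_neg {x δ : ℝ} (hδ : 0 ≤ δ) (h1 : δ ≤ x) (h2 : x ≤ Real.pi - δ) :
    |Real.cos x| ≤ Real.exp (-(δ ^ 2 / 2)) := by
  rcases le_total x (Real.pi / 2) with h | h
  · rw [abs_of_nonneg (Real.cos_nonneg_of_mem_Icc ⟨by linarith, h⟩)]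
    refine (cos_le_exp_neg_sq_div_two (hδ.trans h1) h).trans ?_
    gcongr
  · have h3 : 0 ≤ Real.cos (Real.pi - x) :=
      Real.cos_nonneg_of_mem_Icc ⟨by linarith, by linarith⟩
    have h4 : |Real.cos x| = Real.cos (Real.pi - x) := by
      rw [← abs_of_nonneg h3, Real.cos_pi_sub, abs_neg]
    rw [h4]
    refine (cos_le_exp_neg_sq_div_two (by linarith) (by linarith)).trans ?_
    gcongr
    linarith

/-- The contribution of the non-extremal eigenvalues of the strip of width `H + 2`. -/
noncomputable def subleadingSum (n H : ℕ) : ℝ :=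
  ∑ m ∈ Finset.range H, Real.cos (oddAngle (H + 2) (m + 1) / 2) ^ (2 * n + 2)

theorem sum_cos_pow_eq (n H : ℕ) :
    ∑ m ∈ Finset.range (H + 2), Real.cos (oddAngle (H + 2) m / 2) ^ (2 * n + 2) =
      2 * Real.cos (Real.pi / (2 * (H + 2 : ℕ))) ^ (2 * n + 2) + subleadingSum n H := by
  have hN : ((H : ℝ) + 2) ≠ 0 := by positivity
  have e0 : oddAngle (H + 2) 0 / 2 = Real.pi / (2 * (H + 2 : ℕ)) := by
    simp only [oddAngle]; push_cast; field_simp; ring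
  have e1 : oddAngle (H + 2) (H + 1) / 2 = Real.pi - Real.pi / (2 * (H + 2 : ℕ)) := by
    simp only [oddAngle]; push_cast; field_simp; ring
  have hev : Even (2 * n + 2) := ⟨n + 1, by ring⟩
  rw [Finset.sum_range_succ, Finset.sum_range_succ', e0, e1, Real.cos_pi_sub, hev.neg_pow,
    subleadingSum]
  ring

theorem subleadingSum_nonneg (n H : ℕ) : 0 ≤ subleadingSum n H :=
  Finset.sum_nonneg fun _ _ => Even.pow_nonneg ⟨n + 1, by ring⟩ _

/-- The remaining half-angles stay at distance at least 3π/(2N) from 0 and π; the square of this 3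
is the 9 in the exponent. -/
theorem subleadingSum_le (n H : ℕ) :
    subleadingSum n H ≤ H * Real.exp (-(n * (9 * Real.pi ^ 2 / (4 * (H + 2 : ℕ) ^ 2)))) := by
  have hN : (0 : ℝ) < (H + 2 : ℕ) := by positivity
  have h : ∀ m ∈ Finset.range H, Real.cos (oddAngle (H + 2) (m + 1) / 2) ^ (2 * n + 2) ≤
      Real.exp (-(n * (9 * Real.pi ^ 2 / (4 * (H + 2 : ℕ) ^ 2)))) := by
    intro m hm
    have hm' : (m : ℝ) + 1 ≤ H := by exact_mod_cast Finset.mem_range.1 hm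
    have hev : Even (2 * n + 2) := ⟨n + 1, by ring⟩
    have hb := abs_cos_le_exp_neg (x := oddAngle (H + 2) (m + 1) / 2)
      (δ := 3 * Real.pi / (2 * (H + 2 : ℕ))) (by positivity)
      (by
        rw [oddAngle, div_div, mul_comm ((H + 2 : ℕ) : ℝ) 2]
        have : (3 : ℝ) ≤ 2 * (m + 1 : ℕ) + 1 := by push_cast; linarith [m.cast_nonneg (α := ℝ)]
        gcongr)
      (by
        rw [oddAngle, div_div, mul_comm ((H + 2 : ℕ) : ℝ) 2, le_sub_iff_add_le, ← add_div,
          div_le_iff₀ (by positivity), ← add_mul, mul_comm]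
        gcongr
        push_cast
        linarith)
    rw [← hev.pow_abs]
    calc |Real.cos (oddAngle (H + 2) (m + 1) / 2)| ^ (2 * n + 2)
        ≤ |Real.cos (oddAngle (H + 2) (m + 1) / 2)| ^ (2 * n) :=
          pow_le_pow_of_le_one (abs_nonneg _) (Real.abs_cos_le_one _) (by omega)
      _ ≤ Real.exp (-((3 * Real.pi / (2 * (H + 2 : ℕ))) ^ 2 / 2)) ^ (2 * n) := by gcongr
      _ = _ := by
          rw [← Real.exp_nat_mul]
          congr 1
          push_cast
          field_simp
          ring
  refine (Finset.sum_le_card_nsmul _ _ _ h).trans ?_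
  simp

/-- The factor by which `cos (π / (2 k)) ^ (2 n + 2)` differs from `exp (-n π² / (4 k²))`. -/
noncomputable def cosWeight (n : ℕ) (k : ℤ) : ℝ :=
  if k ≤ 1 then 0 else
    Real.cos (Real.pi / (2 * k)) ^ (2 * n + 2) * Real.exp (n * (Real.pi ^ 2 / (4 * k ^ 2)))

theorem cosWeight_nonneg (n : ℕ) (k : ℤ) : 0 ≤ cosWeight n k := by
  unfold cosWeight
  split_ifs
  · exact le_rfl
  · exact mul_nonneg (Even.pow_nonneg ⟨n + 1, by ring⟩ _) (Real.exp_pos _).le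

theorem cosWeight_eq {n : ℕ} {k : ℤ} (hk : 1 < k) : cosWeight n k =
    Real.cos (Real.pi / (2 * k)) ^ 2 *
      (Real.cos (Real.pi / (2 * k)) * Real.exp ((Real.pi / (2 * k)) ^ 2 / 2)) ^ (2 * n) := by
  have hk' : (0 : ℝ) < k := by exact_mod_cast (by omega : 0 < k)
  rw [cosWeight, if_neg (by omega), mul_pow, ← Real.exp_nat_mul, pow_add]
  have : ((2 * n : ℕ) : ℝ) * ((Real.pi / (2 * k)) ^ 2 / 2) =
      n * (Real.pi ^ 2 / (4 * (k : ℝ) ^ 2)) := by push_cast; field_simp; ring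
  rw [this]
  ring

theorem pi_div_two_mul_mem {k : ℤ} (hk : 1 < k) :
    0 ≤ Real.pi / (2 * k) ∧ Real.pi / (2 * k) ≤ Real.pi / 2 := by
  have hk' : (1 : ℝ) < k := by exact_mod_cast hk
  refine ⟨by positivity, ?_⟩
  gcongr
  linarith

theorem cosWeight_le_one (n : ℕ) (k : ℤ) : cosWeight n k ≤ 1 := by
  rcases le_or_gt k 1 with hk | hk
  · rw [cosWeight, if_pos hk]; exact zero_le_one
  · obtain ⟨h0, h1⟩ := pi_div_two_mul_mem hk
    rw [cosWeight_eq hk]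
    have hc : 0 ≤ Real.cos (Real.pi / (2 * k)) :=
      Real.cos_nonneg_of_mem_Icc ⟨by linarith [Real.pi_pos], h1⟩
    refine mul_le_one₀ (pow_le_one₀ hc (Real.cos_le_one _)) (by positivity) (pow_le_one₀ (by positivity) ?_)
    have := cos_le_exp_neg_sq_div_two h0 h1
    rwa [Real.exp_neg, ← one_div, le_div_iff₀ (Real.exp_pos _)] at this

/-- Bernoulli's inequality applied to cos x · exp(x²/2) ≥ (1 - x²/2)(1 + x²/2) = 1 - x⁴/4. -/
theorem le_cosWeight {n : ℕ} {k : ℤ} (hk : 1 < k) :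
    Real.cos (Real.pi / (2 * k)) ^ 2 * (1 - n * ((Real.pi / (2 * k)) ^ 4 / 2)) ≤ cosWeight n k := by
  obtain ⟨h0, h1⟩ := pi_div_two_mul_mem hk
  rw [cosWeight_eq hk]
  set x := Real.pi / (2 * k)
  have hx2 : x ≤ 2 := by linarith [Real.pi_le_four]
  have hc : 0 ≤ Real.cos x := Real.cos_nonneg_of_mem_Icc ⟨by linarith [Real.pi_pos], h1⟩
  refine mul_le_mul_of_nonneg_left ?_ (sq_nonneg _)
  have h2 : 1 + -(x ^ 4 / 4) ≤ Real.cos x * Real.exp (x ^ 2 / 2) := by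
    have h3 := Real.one_sub_sq_div_two_le_cos (x := x)
    have h4 := Real.add_one_le_exp (x ^ 2 / 2)
    have h5 := mul_le_mul_of_nonneg_left h4 hc
    have h6 := mul_le_mul_of_nonneg_right h3 (show 0 ≤ x ^ 2 / 2 + 1 by positivity)
    nlinarith
  have h7 : 1 + ((2 * n : ℕ) : ℝ) * (-(x ^ 4 / 4)) ≤ (1 + -(x ^ 4 / 4)) ^ (2 * n) := by
    rcases le_total (-1) (1 + -(x ^ 4 / 4)) with h | h
    · exact one_add_mul_le_pow (by linarith) _
    · have : 0 ≤ (1 + -(x ^ 4 / 4)) ^ (2 * n) := Even.pow_nonneg ⟨n, by ring⟩ _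
      rcases Nat.eq_zero_or_pos n with rfl | hn
      · simp
      · have : (1 : ℝ) ≤ n := by exact_mod_cast hn
        push_cast
        nlinarith
  rcases le_total 0 (1 + -(x ^ 4 / 4)) with h | h
  · refine le_trans (le_of_eq ?_) (h7.trans (pow_le_pow_left₀ h h2 _))
    push_cast; ring
  · rcases Nat.eq_zero_or_pos n with rfl | hn
    · simp
    · have h8 : (1 : ℝ) ≤ n := by exact_mod_cast hn
      have h9 : 1 - n * (x ^ 4 / 2) ≤ 0 := by nlinarith
      exact h9.trans (by positivity)

theorem tendsto_cosWeight {c : ℝ} {a : ℕ → ℝ} (ha : Tendsto a atTop atTop)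
    (hac : ∀ n : ℕ, (n : ℝ) = c * a n ^ 3) (k : ℕ → ℤ)
    (hk : Tendsto (fun n => (k n : ℝ) / a n) atTop (𝓝 1)) :
    Tendsto (fun n => cosWeight n (k n)) atTop (𝓝 1) := by
  have hkt : Tendsto (fun n => (k n : ℝ)) atTop atTop := by
    refine (hk.pos_mul_atTop one_pos ha).congr' ?_
    filter_upwards [ha.eventually_gt_atTop 0] with n hn
    field_simp
  have hi : Tendsto (fun n => (k n : ℝ)⁻¹) atTop (𝓝 0) := hkt.inv_tendsto_atTop
  have hcos : Tendsto (fun n => Real.cos (Real.pi / (2 * k n))) atTop (𝓝 1) := by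
    have : Tendsto (fun n => Real.pi / 2 * (k n : ℝ)⁻¹) atTop (𝓝 0) := by
      simpa using hi.const_mul (Real.pi / 2)
    have h := (Real.continuous_cos.tendsto 0).comp this
    rw [Real.cos_zero] at h
    refine h.congr fun n => ?_
    simp only [Function.comp]
    congr 1
    rw [← div_eq_mul_inv, div_div]
  -- Since n = c a³ and k ~ a, this is of order 1/k.
  have hr : Tendsto (fun n : ℕ => (n : ℝ) * ((Real.pi / (2 * k n)) ^ 4 / 2)) atTop (𝓝 0) := by
    have h := (((hk.inv₀ one_ne_zero).pow 3).mul hi).const_mul (c * Real.pi ^ 4 / 32)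
    simp only [mul_zero] at h
    refine h.congr' ?_
    filter_upwards [ha.eventually_gt_atTop 0, hkt.eventually_gt_atTop 0] with n h1 h2
    rw [hac n]
    field_simp
    ring
  have hlow := (hcos.pow 2).mul (hr.const_sub 1)
  simp only [one_pow, sub_zero, mul_one] at hlow
  refine tendsto_of_tendsto_of_tendsto_of_le_of_le' hlow tendsto_const_nhds ?_
    (Eventually.of_forall fun n => cosWeight_le_one _ _)
  filter_upwards [hkt.eventually_gt_atTop 1] with n hn
  exact le_cosWeight (by exact_mod_cast hn)

/-! ### The saddle point and the constants -/

/-- The height at which `u k + n π² / (4 k²)` is minimal. -/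
noncomputable def saddlePoint (u : ℝ) (n : ℕ) : ℝ :=
  (2 : ℝ) ^ (-(1 / 3) : ℝ) * Real.pi ^ (2 / 3 : ℝ) * u ^ (-(1 / 3) : ℝ) * (n : ℝ) ^ (1 / 3 : ℝ)

/-- Expressing fractional powers through sixth roots turns identities between constants into
rational ones. -/
theorem rpow_div_six {x : ℝ} (hx : 0 ≤ x) (k : ℕ) : x ^ (k / 6 : ℝ) = (x ^ (1 / 6 : ℝ)) ^ k := by
  rw [← Real.rpow_natCast, ← Real.rpow_mul hx]
  congr 1
  ring

theorem pow_six_rpow {x : ℝ} (hx : 0 ≤ x) : (x ^ (1 / 6 : ℝ)) ^ 6 = x := by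
  rw [← rpow_div_six hx 6]
  norm_num

theorem saddlePoint_eq {u : ℝ} (hu : 0 < u) (n : ℕ) : saddlePoint u n =
    ((Real.pi ^ (1 / 6 : ℝ)) ^ 2 * (n : ℝ) ^ (1 / 6 : ℝ) /
      ((2 : ℝ) ^ (1 / 6 : ℝ) * u ^ (1 / 6 : ℝ))) ^ 2 := by
  rw [saddlePoint, Real.rpow_neg (by norm_num), Real.rpow_neg hu.le]
  rw [show (1 / 3 : ℝ) = (2 : ℕ) / 6 by norm_num, show (2 / 3 : ℝ) = (4 : ℕ) / 6 by norm_num,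
    rpow_div_six (by norm_num), rpow_div_six Real.pi_pos.le, rpow_div_six hu.le,
    rpow_div_six n.cast_nonneg]
  field_simp

theorem sqrt_saddlePoint {u : ℝ} (hu : 0 < u) (n : ℕ) : √(saddlePoint u n) =
    (Real.pi ^ (1 / 6 : ℝ)) ^ 2 * (n : ℝ) ^ (1 / 6 : ℝ) /
      ((2 : ℝ) ^ (1 / 6 : ℝ) * u ^ (1 / 6 : ℝ)) := by
  rw [saddlePoint_eq hu, Real.sqrt_sq (by positivity)]

/-- The stationarity equation of uk + nπ²/(4k²). -/
theorem natCast_mul_pi_sq {u : ℝ} (hu : 0 < u) (n : ℕ) :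
    n * Real.pi ^ 2 = 2 * u * saddlePoint u n ^ 3 := by
  have h2 := pow_six_rpow (x := 2) (by norm_num)
  have hp := pow_six_rpow Real.pi_pos.le
  have hn := pow_six_rpow (x := n) n.cast_nonneg
  have hu' := pow_six_rpow hu.le
  rw [saddlePoint_eq hu, ← pow_mul, div_pow, mul_pow, mul_pow, ← pow_mul, mul_comm 2 (2 * 3),
    pow_mul, show 2 * 3 = 6 from rfl, h2, hp, hn, hu']
  field_simp

theorem rateConst_mul {u : ℝ} (hu : 0 < u) (n : ℕ) :
    rateConst u * (n : ℝ) ^ (1 / 3 : ℝ) = 3 / 2 * u * saddlePoint u n := by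
  have h2 := pow_six_rpow (x := 2) (by norm_num)
  have hu' := pow_six_rpow hu.le
  rw [rateConst, saddlePoint_eq hu, Real.rpow_neg (by norm_num)]
  rw [show (1 / 3 : ℝ) = (2 : ℕ) / 6 by norm_num, show (2 / 3 : ℝ) = (4 : ℕ) / 6 by norm_num,
    show (4 / 3 : ℝ) = (8 : ℕ) / 6 by norm_num,
    rpow_div_six (by norm_num), rpow_div_six Real.pi_pos.le, rpow_div_six hu.le,
    rpow_div_six n.cast_nonneg]
  generalize u ^ (1 / 6 : ℝ) = q at *
  have hr : (0 : ℝ) < 2 ^ (1 / 6 : ℝ) := by positivity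
  generalize (2 : ℝ) ^ (1 / 6 : ℝ) = r at *
  have hq : q ≠ 0 := by rintro rfl; norm_num at hu'; exact hu.ne hu'
  subst hu'
  field_simp
  rw [h2]
  ring

theorem amplitudeConst_mul {u : ℝ} (hu : 0 < u) {n : ℕ} (hn : 0 < n) :
    amplitudeConst u * (n : ℝ) ^ (-(1 / 6) : ℝ) =
      Real.exp u * (Real.exp u - 1) * (4 * √(2 * Real.pi / (3 * u))) *
        (√(saddlePoint u n))⁻¹ := by
  have h2 := pow_six_rpow (x := 2) (by norm_num)
  have hu' := pow_six_rpow hu.le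
  have hp := pow_six_rpow Real.pi_pos.le
  have hn' : (0 : ℝ) < n := by exact_mod_cast hn
  have hs : √(2 * Real.pi / (3 * u)) = ((2 : ℝ) ^ (1 / 6 : ℝ)) ^ 3 * (Real.pi ^ (1 / 6 : ℝ)) ^ 3 /
      (√3 * (u ^ (1 / 6 : ℝ)) ^ 3) := by
    rw [Real.sqrt_eq_iff_mul_self_eq (by positivity) (by positivity)]
    have h3 : √3 * √3 = 3 := Real.mul_self_sqrt (by norm_num)
    rw [div_mul_div_comm]
    rw [show √3 * (u ^ (1 / 6 : ℝ)) ^ 3 * (√3 * (u ^ (1 / 6 : ℝ)) ^ 3) =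
      (√3 * √3) * (u ^ (1 / 6 : ℝ)) ^ 6 by ring, h3, hu',
      show ((2 : ℝ) ^ (1 / 6 : ℝ)) ^ 3 * (Real.pi ^ (1 / 6 : ℝ)) ^ 3 *
        (((2 : ℝ) ^ (1 / 6 : ℝ)) ^ 3 * (Real.pi ^ (1 / 6 : ℝ)) ^ 3) =
        ((2 : ℝ) ^ (1 / 6 : ℝ)) ^ 6 * (Real.pi ^ (1 / 6 : ℝ)) ^ 6 by ring, h2, hp]
  rw [amplitudeConst, sqrt_saddlePoint hu, hs, Real.rpow_neg (by norm_num),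
    Real.rpow_neg hu.le, Real.rpow_neg hn'.le, ← Real.sqrt_eq_rpow]
  rw [show (1 / 3 : ℝ) = (2 : ℕ) / 6 by norm_num,
    show (8 / 3 : ℝ) = (16 : ℕ) / 6 by norm_num,
    rpow_div_six (by norm_num), rpow_div_six hu.le]
  have hr : (0 : ℝ) < 2 ^ (1 / 6 : ℝ) := by positivity
  generalize (2 : ℝ) ^ (1 / 6 : ℝ) = r at *
  have h4 : r ^ 16 = 4 * r ^ 4 := by
    rw [show r ^ 16 = (r ^ 6) ^ 2 * r ^ 4 by ring, h2]; norm_num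
  rw [h4]
  field_simp

theorem tendsto_saddlePoint {u : ℝ} (hu : 0 < u) : Tendsto (saddlePoint u) atTop atTop := by
  unfold saddlePoint
  exact ((tendsto_rpow_atTop (by norm_num)).comp tendsto_natCast_atTop_atTop).const_mul_atTop
    (by positivity)

/-! ### Leading and error contributions -/

/-- The contribution of the leading eigenvalue of the strip of width `H + 2`. -/
noncomputable def leadingTerm (u : ℝ) (n H : ℕ) : ℝ :=
  Real.exp (-u * H) * (4 / (H + 2 : ℕ) * Real.cos (Real.pi / (2 * (H + 2 : ℕ))) ^ (2 * n + 2))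

/-- The contribution of the other eigenvalues of the strip of width `H + 2`. -/
noncomputable def errorTerm (u : ℝ) (n H : ℕ) : ℝ :=
  Real.exp (-u * H) * (2 / (H + 2 : ℕ) * subleadingSum n H)

theorem summable_exp_neg_mul {u : ℝ} (hu : 0 < u) : Summable fun H : ℕ => Real.exp (-u * H) := by
  have := Real.summable_exp_nat_mul_iff.2 (show -u < 0 by linarith)
  simpa [mul_comm] using this

theorem leadingTerm_nonneg (u : ℝ) (n H : ℕ) : 0 ≤ leadingTerm u n H := by
  have : 0 ≤ Real.cos (Real.pi / (2 * (H + 2 : ℕ))) ^ (2 * n + 2) :=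
    Even.pow_nonneg ⟨n + 1, by ring⟩ _
  unfold leadingTerm
  positivity

theorem summable_leadingTerm {u : ℝ} (hu : 0 < u) (n : ℕ) : Summable (leadingTerm u n) := by
  refine Summable.of_nonneg_of_le (leadingTerm_nonneg u n) (fun H => ?_)
    ((summable_exp_neg_mul hu).mul_right 2)
  unfold leadingTerm
  gcongr
  have h1 : Real.cos (Real.pi / (2 * (H + 2 : ℕ))) ^ (2 * n + 2) ≤ 1 := by
    rw [← Even.pow_abs ⟨n + 1, by ring⟩]
    exact pow_le_one₀ (abs_nonneg _) (Real.abs_cos_le_one _)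
  have h2 : (4 : ℝ) / (H + 2 : ℕ) ≤ 2 := by
    rw [div_le_iff₀ (by positivity)]; push_cast; linarith [H.cast_nonneg (α := ℝ)]
  calc _ ≤ (4 : ℝ) / (H + 2 : ℕ) * 1 := by gcongr
    _ ≤ 2 := by linarith

theorem errorTerm_nonneg (u : ℝ) (n H : ℕ) : 0 ≤ errorTerm u n H := by
  have := subleadingSum_nonneg n H
  unfold errorTerm
  positivity

/-- Half of the weight e^{-uH} is kept for summability in H. The other half still gives a rate 15/8,
above the leading 3/2. -/
theorem errorTerm_le {u : ℝ} (hu : 0 < u) (n H : ℕ) : errorTerm u n H ≤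
    2 * Real.exp u * Real.exp (-(15 / 8 * u * saddlePoint u n)) * Real.exp (-(u / 2) * H) := by
  have hN : (0 : ℝ) < (H + 2 : ℕ) := by positivity
  have ha0 : 0 ≤ saddlePoint u n := by unfold saddlePoint; positivity
  have hn := natCast_mul_pi_sq hu n
  have hH : (H : ℝ) = (H + 2 : ℕ) - 2 := by push_cast; ring
  have h1 : 2 / (H + 2 : ℕ) * subleadingSum n H ≤
      2 * Real.exp (-(n * (9 * Real.pi ^ 2 / (4 * (H + 2 : ℕ) ^ 2)))) := by
    have h2 := subleadingSum_le n H
    have h3 : (H : ℝ) ≤ (H + 2 : ℕ) := by push_cast; linarith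
    rw [div_mul_eq_mul_div, div_le_iff₀ hN, mul_assoc]
    refine mul_le_mul_of_nonneg_left (h2.trans ?_) zero_le_two
    rw [mul_comm]
    gcongr
  have h4 : -u * H + -(n * (9 * Real.pi ^ 2 / (4 * ((H + 2 : ℕ) : ℝ) ^ 2))) ≤
      u + -(15 / 8 * u * saddlePoint u n) + -(u / 2) * H := by
    have e : n * (9 * Real.pi ^ 2 / (4 * ((H + 2 : ℕ) : ℝ) ^ 2)) =
        9 * (n * Real.pi ^ 2) / (4 * ((H + 2 : ℕ) : ℝ) ^ 2) := by ring
    rw [e, hn, hH]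
    generalize ((H + 2 : ℕ) : ℝ) = N at *
    generalize saddlePoint u n = a at *
    have key : 15 / 8 * a ≤ N / 2 + 9 * a ^ 3 / (2 * N ^ 2) := by
      rw [← sub_nonneg]
      have : N / 2 + 9 * a ^ 3 / (2 * N ^ 2) - 15 / 8 * a =
          (4 * N ^ 3 + 36 * a ^ 3 - 15 * a * N ^ 2) / (8 * N ^ 2) := by field_simp; ring
      rw [this]
      apply div_nonneg _ (by positivity)
      -- The numerator is (2N - 5a)²(N + 5a/4) + (19/4)a³; N = 5a/2 is close to the true minimiser
      -- 18^{1/3} a.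
      nlinarith [mul_nonneg hN.le (sq_nonneg (2 * N - 5 * a)),
        mul_nonneg ha0 (sq_nonneg (2 * N - 5 * a)), pow_nonneg ha0 3]
    have := mul_le_mul_of_nonneg_left key hu.le
    have e2 : u * (N / 2 + 9 * a ^ 3 / (2 * N ^ 2)) =
      u * N / 2 + 9 * (2 * u * a ^ 3) / (4 * N ^ 2) := by field_simp; ring
    rw [e2] at this
    linarith
  calc errorTerm u n H
      ≤ Real.exp (-u * H) * (2 * Real.exp (-(n * (9 * Real.pi ^ 2 / (4 * (H + 2 : ℕ) ^ 2))))) := by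
        unfold errorTerm; gcongr
    _ = 2 * Real.exp (-u * H + -(n * (9 * Real.pi ^ 2 / (4 * ((H + 2 : ℕ) : ℝ) ^ 2)))) := by
        rw [Real.exp_add]; ring
    _ ≤ 2 * Real.exp (u + -(15 / 8 * u * saddlePoint u n) + -(u / 2) * H) := by gcongr
    _ = _ := by rw [Real.exp_add, Real.exp_add]; ring

theorem summable_errorTerm {u : ℝ} (hu : 0 < u) (n : ℕ) : Summable (errorTerm u n) :=
  Summable.of_nonneg_of_le (errorTerm_nonneg u n) (errorTerm_le hu n)
    ((summable_exp_neg_mul (half_pos hu)).mul_left _)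

theorem halfPlaneExpectation_eq {u : ℝ} (hu : 0 < u) (n : ℕ) :
    halfPlaneExpectation n (fun η => Real.exp (-u * (maxHeight η : ℝ))) =
      (1 - Real.exp (-u)) * (∑' H, leadingTerm u n H + ∑' H, errorTerm u n H) := by
  rw [← (hasSum_halfPlaneExpectation hu n).tsum_eq,
    ← (summable_leadingTerm hu n).tsum_add (summable_errorTerm hu n), ← tsum_mul_left]
  refine tsum_congr fun H => ?_
  rw [card_stripPaths, sum_cos_pow_eq, leadingTerm, errorTerm]
  ring

theorem tendsto_leadingTerm {u : ℝ} (hu : 0 < u) :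
    Tendsto (fun n => √(saddlePoint u n) * Real.exp (3 / 2 * u * saddlePoint u n) *
      ∑' H, leadingTerm u n H) atTop
      (𝓝 (Real.exp (2 * u) * (4 * √(2 * Real.pi / (3 * u))))) := by
  have h := (tendsto_sqrt_mul_tsum_saddlePhase hu (tendsto_saddlePoint hu) cosWeight_nonneg
    cosWeight_le_one (fun n k hk => if_pos (by omega))
    (fun k => tendsto_cosWeight (c := 2 * u / Real.pi ^ 2) (tendsto_saddlePoint hu) (fun n => by
      have := natCast_mul_pi_sq hu n
      field_simp
      exact this) k)).const_mul (Real.exp (2 * u) * 4)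
  rw [← mul_assoc]
  refine h.congr fun n => ?_
  have hinj : Function.Injective fun H : ℕ => (H : ℤ) + 2 := fun x y h => by
    simpa using h
  rw [← hinj.tsum_eq, mul_left_comm (Real.exp (2 * u) * 4), mul_assoc (√(saddlePoint u n))]
  · congr 1
    rw [← tsum_mul_left, ← tsum_mul_left]
    refine tsum_congr fun H => ?_
    have hN : (((H : ℤ) + 2 : ℤ) : ℝ) = (H + 2 : ℕ) := by push_cast; ring
    have hN0 : (0 : ℝ) < (H + 2 : ℕ) := by positivity
    have hH : (H : ℝ) = (H + 2 : ℕ) - 2 := by push_cast; ring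
    have hn := natCast_mul_pi_sq hu n
    rw [cosWeight, if_neg (by omega), leadingTerm, hN, hH]
    generalize ((H + 2 : ℕ) : ℝ) = N at *
    generalize saddlePoint u n = a at *
    -- The shift H = N - 2 produces the factor e^{2u}; the minimum 3ua/2 is what the phase
    -- subtracts.
    have e : 2 * u + n * (Real.pi ^ 2 / (4 * N ^ 2)) + -u * saddlePhase a N =
        3 / 2 * u * a + -u * (N - 2) := by
      have : n * (Real.pi ^ 2 / (4 * N ^ 2)) = n * Real.pi ^ 2 / (4 * N ^ 2) := by ring
      rw [this, hn, saddlePhase]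
      field_simp
      ring
    have e2 : Real.exp (2 * u) * Real.exp (n * (Real.pi ^ 2 / (4 * N ^ 2))) *
        Real.exp (-u * saddlePhase a N) =
        Real.exp (3 / 2 * u * a) * Real.exp (-u * (N - 2)) := by
      rw [← Real.exp_add, ← Real.exp_add, ← Real.exp_add, e]
    linear_combination (4 * Real.cos (Real.pi / (2 * N)) ^ (2 * n + 2) * N⁻¹) * e2
  · intro k hk
    by_contra hr
    apply hk
    have : k ≤ 1 := by
      by_contra! hlt
      exact hr ⟨(k - 2).toNat, by simp only; omega⟩
    simp [cosWeight, this]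

theorem tendsto_errorTerm {u : ℝ} (hu : 0 < u) :
    Tendsto (fun n => √(saddlePoint u n) * Real.exp (3 / 2 * u * saddlePoint u n) *
      ∑' H, errorTerm u n H) atTop (𝓝 0) := by
  set S := ∑' H : ℕ, Real.exp (-(u / 2) * H)
  -- The rate 3/8 is the gap 15/8 - 3/2.
  have h1 : Tendsto (fun n => saddlePoint u n ^ (1 / 2 : ℝ) *
      Real.exp (-(3 / 8 * u) * saddlePoint u n) * (2 * Real.exp u * S)) atTop (𝓝 0) := by
    simpa using ((tendsto_rpow_mul_exp_neg_mul_atTop_nhds_zero (1 / 2) (3 / 8 * u)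
      (by positivity)).comp (tendsto_saddlePoint hu)).mul_const (2 * Real.exp u * S)
  refine squeeze_zero (fun n => ?_) (fun n => ?_) h1
  · have : 0 ≤ ∑' H, errorTerm u n H := tsum_nonneg (errorTerm_nonneg u n)
    positivity
  · have h2 := (summable_errorTerm hu n).tsum_le_tsum (errorTerm_le hu n)
      ((summable_exp_neg_mul (half_pos hu)).mul_left _)
    rw [tsum_mul_left] at h2
    rw [← Real.sqrt_eq_rpow]
    calc _ ≤ √(saddlePoint u n) * Real.exp (3 / 2 * u * saddlePoint u n) *
          (2 * Real.exp u * Real.exp (-(15 / 8 * u * saddlePoint u n)) * S) := by gcongr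
      _ = √(saddlePoint u n) * (Real.exp (3 / 2 * u * saddlePoint u n) *
          Real.exp (-(15 / 8 * u * saddlePoint u n))) * (2 * Real.exp u * S) := by ring
      _ = _ := by
        rw [← Real.exp_add]
        congr 3
        ring

theorem mainTheorem2 (u : ℝ) (hu : 0 < u) :
    Asymptotics.IsEquivalent Filter.atTop
      (fun n : ℕ => halfPlaneExpectation n (fun η => Real.exp (-u * (maxHeight η : ℝ))))
      (fun n : ℕ => amplitudeConst u * (n : ℝ) ^ (-(1 / 6) : ℝ) *
        Real.exp (-rateConst u * (n : ℝ) ^ (1 / 3 : ℝ))) := by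
  have hE : 0 < Real.exp u - 1 := by simpa using hu
  have h := ((tendsto_leadingTerm hu).add (tendsto_errorTerm hu)).const_mul (1 - Real.exp (-u))
  rw [add_zero, show (1 - Real.exp (-u)) * (Real.exp (2 * u) * (4 * √(2 * Real.pi / (3 * u)))) =
    Real.exp u * (Real.exp u - 1) * (4 * √(2 * Real.pi / (3 * u))) by
      rw [two_mul, Real.exp_add, Real.exp_neg]; field_simp] at h
  have hequiv := ((Asymptotics.isEquivalent_const_iff_tendsto (by positivity)).2 h).mul
    (Asymptotics.IsEquivalent.refl (u := fun n =>
      (√(saddlePoint u n))⁻¹ * Real.exp (-(3 / 2 * u * saddlePoint u n))) (l := atTop))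
  refine (hequiv.congr_left ?_).congr_right ?_
  · filter_upwards [(tendsto_saddlePoint hu).eventually_gt_atTop 0] with n hn
    have hs : √(saddlePoint u n) ≠ 0 := (Real.sqrt_pos.2 hn).ne'
    rw [halfPlaneExpectation_eq hu]
    simp only [Pi.mul_apply]
    have he : √(saddlePoint u n) * (√(saddlePoint u n))⁻¹ *
        (Real.exp (3 / 2 * u * saddlePoint u n) * Real.exp (-(3 / 2 * u * saddlePoint u n))) = 1 := by
      rw [mul_inv_cancel₀ hs, ← Real.exp_add, add_neg_cancel, Real.exp_zero, one_mul]
    linear_combination (1 - Real.exp (-u)) *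
      (∑' H, leadingTerm u n H + ∑' H, errorTerm u n H) * he
  · filter_upwards [eventually_gt_atTop 0] with n hn
    rw [amplitudeConst_mul hu hn, neg_mul, rateConst_mul hu]
    simp only [Pi.mul_apply, Function.const_apply]
    ring
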